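/- Let $d\ge 1$. For an open set $\Omega\subseteq\mathbb R^d$ let $\mathcal G(\Omega)=\mathcal E_M(\Omega)/\mathcal N(\Omega)$ be the special Colombeau algebra: $\mathcal E_M(\Omega)$ is the algebra of nets $(u_\varepsilon)_{\varepsilon\in(0,1]}$ of complex-valued $C^\infty$ functions on $\Omega$ such that for every compact $K\subseteq\Omega$ and every $\beta\in\mathbb N_0^d$ there is $N\ge 0$ with $\sup_{x\in K}|\partial^\beta u_\varepsilon(x)|=O(\varepsilon^{-N})$ as $\varepsilon\to 0$, and $\mathcal N(\Omega)$ is the ideal of those nets such that for every compact $K\subseteq\Omega$, every $\beta\in\mathbb N_0^d$ and every $m\ge 0$ one has $\sup_{x\in K}|\partial^\beta u_\varepsilon(x)|=O(\varepsilon^{m})$ as $\varepsilon\to0$. Restriction to open subsets and the scaling $u(x)\mapsto u(\lambda x)$ (for $\lambda>0$, where $\Omega$ is $\mathbb R^d$ or $\mathbb R^d\setminus\{0\}$) are defined on representatives. An element $u$ of $\mathcal G(\mathbb R^d)$ (resp. $\mathcal G(\mathbb R^d\setminus\{0\})$) is called homogeneous of degree $\alpha\in\mathbb R$ if for each real $\lambda>0$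 the equality $u(\lambda x)=\lambda^\alpha u(x)$ holds in $\mathcal G(\mathbb R^d)$ (resp. $\mathcal G(\mathbb R^d\setminus\{0\})$). **Theorem.** Let $\alpha\in\mathbb R$ and let $u\in\mathcal G(\mathbb R^d\setminus\{0\})$, $u\ne 0$, be homogeneous of degree $\alpha$. 1. $u$ is extendable: there exists $\hat u\in\mathcal G(\mathbb R^d)$ with $\hat u|_{\mathbb R^d\setminus\{0\}}=u$ in $\mathcal G(\mathbb R^d\setminus\{0\})$. 2. If $u$ is extendable as a homogeneous function, that is, if there exist $\beta\in\mathbb R$ and $\hat u\in\mathcal G(\mathbb R^d)$ homogeneous of degree $\beta$ with $\hat u|_{\mathbb R^d\setminus\{0\}}=u$ in $\mathcal G(\mathbb R^d\setminus\{0\})$, then $\alpha\in\mathbb N_0$. -/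

import Mathlib

open scoped ContDiff

namespace Colombeau

/-- Nets `(u_ε)` of complex valued functions on `ℝ^d`, indexed by `ε ∈ (0,1]`. Below, such a net
represents a net of functions on an open set `Ω`: only its values on `Ω` matter. -/
abbrev Net (d : ℕ) : Type := Set.Ioc (0 : ℝ) 1 → EuclideanSpace ℝ (Fin d) → ℂ

/-- `sup_{x ∈ K} φ_ε(x) = O(ε^m)` as `ε → 0`. -/
def SupIsBigO {X : Type*} (K : Set X) (φ : Set.Ioc (0 : ℝ) 1 → X → ℝ) (m : ℤ) : Prop :=
  ∃ C : ℝ, ∃ η : ℝ, 0 < η ∧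
    ∀ ε : Set.Ioc (0 : ℝ) 1, (ε : ℝ) < η → ∀ x ∈ K, φ ε x ≤ C * (ε : ℝ) ^ m

namespace SupIsBigO

variable {X : Type*} {K : Set X} {φ ψ : Set.Ioc (0 : ℝ) 1 → X → ℝ} {m n : ℤ}

lemma anti (h : SupIsBigO K φ m) (hnm : n ≤ m) : SupIsBigO K φ n := by
  obtain ⟨C, η, hη, h⟩ := h
  refine ⟨|C|, η, hη, fun ε hε x hx => (h ε hε x hx).trans ?_⟩
  have h0 : (0 : ℝ) < ε := ε.2.1
  have h1 : (ε : ℝ) ^ m ≤ (ε : ℝ) ^ n := zpow_le_zpow_right_of_le_one₀ h0 ε.2.2 hnm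
  exact mul_le_mul (le_abs_self C) h1 (zpow_pos h0 m).le (abs_nonneg C)

lemma le (h : SupIsBigO K φ m) (hψ : ∀ ε, ∀ x ∈ K, ψ ε x ≤ φ ε x) : SupIsBigO K ψ m := by
  obtain ⟨C, η, hη, h⟩ := h
  exact ⟨C, η, hη, fun ε hε x hx => (hψ ε x hx).trans (h ε hε x hx)⟩

lemma add (hφ : SupIsBigO K φ m) (hψ : SupIsBigO K ψ m) :
    SupIsBigO K (fun ε x => φ ε x + ψ ε x) m := by
  obtain ⟨C, η, hη, h⟩ := hφ
  obtain ⟨C', η', hη', h'⟩ := hψ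
  refine ⟨C + C', min η η', lt_min hη hη', fun ε hε x hx => ?_⟩
  rw [add_mul]
  exact add_le_add (h ε (hε.trans_le (min_le_left _ _)) x hx)
    (h' ε (hε.trans_le (min_le_right _ _)) x hx)

lemma mul (hφ : SupIsBigO K φ m) (hψ : SupIsBigO K ψ n)
    (hφ0 : ∀ ε x, 0 ≤ φ ε x) (hψ0 : ∀ ε x, 0 ≤ ψ ε x) :
    SupIsBigO K (fun ε x => φ ε x * ψ ε x) (m + n) := by
  obtain ⟨C, η, hη, h⟩ := hφ
  obtain ⟨C', η', hη', h'⟩ := hψ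
  refine ⟨C * C', min η η', lt_min hη hη', fun ε hε x hx => ?_⟩
  have h1 := h ε (hε.trans_le (min_le_left _ _)) x hx
  have h2 := h' ε (hε.trans_le (min_le_right _ _)) x hx
  have h0 : (ε : ℝ) ≠ 0 := ε.2.1.ne'
  calc φ ε x * ψ ε x ≤ (C * (ε : ℝ) ^ m) * (C' * (ε : ℝ) ^ n) :=
        mul_le_mul h1 h2 (hψ0 ε x) ((hφ0 ε x).trans h1)
    _ = C * C' * (ε : ℝ) ^ (m + n) := by rw [zpow_add₀ h0]; ring

lemma const_mul {c : ℝ} (hc : 0 ≤ c) (hφ : SupIsBigO K φ m) :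
    SupIsBigO K (fun ε x => c * φ ε x) m := by
  obtain ⟨C, η, hη, h⟩ := hφ
  refine ⟨c * C, η, hη, fun ε hε x hx => ?_⟩
  rw [mul_assoc]
  exact mul_le_mul_of_nonneg_left (h ε hε x hx) hc

lemma zero : SupIsBigO K (fun _ _ => 0) m := ⟨0, 1, one_pos, fun _ _ _ _ => by simp⟩

lemma sum {ι : Type*} {s : Finset ι} {Φ : ι → Set.Ioc (0 : ℝ) 1 → X → ℝ}
    (h : ∀ i ∈ s, SupIsBigO K (Φ i) m) : SupIsBigO K (fun ε x => ∑ i ∈ s, Φ i ε x) m := by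
  classical
  induction s using Finset.induction_on with
  | empty => simpa using zero
  | insert a s ha ih =>
    simp only [Finset.sum_insert ha]
    exact (h a (Finset.mem_insert_self _ _)).add
      (ih fun i hi => h i (Finset.mem_insert_of_mem hi))

lemma sum_of_exists {ι : Type*} {s : Finset ι} {Φ : ι → Set.Ioc (0 : ℝ) 1 → X → ℝ}
    (h : ∀ i ∈ s, ∃ N : ℕ, SupIsBigO K (Φ i) (-(N : ℤ))) :
    ∃ N : ℕ, SupIsBigO K (fun ε x => ∑ i ∈ s, Φ i ε x) (-(N : ℤ)) := by
  choose! N hN using h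
  refine ⟨∑ i ∈ s, N i, sum fun i hi => (hN i hi).anti ?_⟩
  have : N i ≤ ∑ i ∈ s, N i := Finset.single_le_sum (fun _ _ => Nat.zero_le _) hi
  omega

end SupIsBigO

section

variable {d : ℕ}

/-- Every member of the net is of class `C^∞` on `Ω`. -/
def IsSmooth (Ω : TopologicalSpace.Opens (EuclideanSpace ℝ (Fin d))) (u : Net d) : Prop :=
  ∀ ε, ContDiffOn ℝ ∞ (u ε) Ω

/-- Moderateness on `Ω`: for all compact `K ⊆ Ω` and all orders `k` there is `N` such that the
derivatives of order `k` of `u_ε` are `O(ε^(-N))`, uniformly on `K`. (The norm of the `k`-th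
derivative is equivalent to the maximum of the moduli of all partial derivatives of order `k`.) -/
def IsModerate (Ω : TopologicalSpace.Opens (EuclideanSpace ℝ (Fin d))) (u : Net d) : Prop :=
  ∀ K : Set (EuclideanSpace ℝ (Fin d)), IsCompact K → K ⊆ Ω → ∀ k : ℕ, ∃ N : ℕ,
    SupIsBigO K (fun ε x => ‖iteratedFDeriv ℝ k (u ε) x‖) (-(N : ℤ))

/-- Negligibility on `Ω`: for all compact `K ⊆ Ω`, all orders `k` and all `m`, the derivatives of
order `k` of `u_ε` are `O(ε^m)`, uniformly on `K`. -/
def IsNegligible (Ω : TopologicalSpace.Opens (EuclideanSpace ℝ (Fin d))) (u : Net d) : Prop :=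
  ∀ K : Set (EuclideanSpace ℝ (Fin d)), IsCompact K → K ⊆ Ω → ∀ k : ℕ, ∀ m : ℕ,
    SupIsBigO K (fun ε x => ‖iteratedFDeriv ℝ k (u ε) x‖) (m : ℤ)

variable {Ω Ω' : TopologicalSpace.Opens (EuclideanSpace ℝ (Fin d))} {u v : Net d}

lemma norm_iteratedFDeriv_add_le (hu : IsSmooth Ω u) (hv : IsSmooth Ω v) (k : ℕ)
    (ε : Set.Ioc (0 : ℝ) 1) {x : EuclideanSpace ℝ (Fin d)} (hx : x ∈ Ω) :
    ‖iteratedFDeriv ℝ k ((u + v) ε) x‖ ≤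
      ‖iteratedFDeriv ℝ k (u ε) x‖ + ‖iteratedFDeriv ℝ k (v ε) x‖ := by
  have h1 : ContDiffAt ℝ k (u ε) x :=
    ((hu ε).contDiffAt (Ω.isOpen.mem_nhds hx)).of_le (by exact_mod_cast le_top)
  have h2 : ContDiffAt ℝ k (v ε) x :=
    ((hv ε).contDiffAt (Ω.isOpen.mem_nhds hx)).of_le (by exact_mod_cast le_top)
  rw [Pi.add_apply, iteratedFDeriv_add_apply h1 h2]
  exact norm_add_le _ _

lemma norm_iteratedFDeriv_mul_le (hu : IsSmooth Ω u) (hv : IsSmooth Ω v) (k : ℕ)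
    (ε : Set.Ioc (0 : ℝ) 1) {x : EuclideanSpace ℝ (Fin d)} (hx : x ∈ Ω) :
    ‖iteratedFDeriv ℝ k ((u * v) ε) x‖ ≤ ∑ i ∈ Finset.range (k + 1), (k.choose i : ℝ) *
      (‖iteratedFDeriv ℝ i (u ε) x‖ * ‖iteratedFDeriv ℝ (k - i) (v ε) x‖) := by
  have h := norm_iteratedFDerivWithin_mul_le (n := k) (hu ε) (hv ε) Ω.isOpen.uniqueDiffOn hx
    (by exact_mod_cast le_top)
  simp only [iteratedFDerivWithin_of_isOpen _ Ω.isOpen hx, mul_assoc] at h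
  exact h

lemma norm_iteratedFDeriv_comp_le (hu : IsSmooth Ω' u)
    (L : EuclideanSpace ℝ (Fin d) →L[ℝ] EuclideanSpace ℝ (Fin d)) (k : ℕ)
    (ε : Set.Ioc (0 : ℝ) 1) {x : EuclideanSpace ℝ (Fin d)} (hx : L x ∈ Ω') :
    ‖iteratedFDeriv ℝ k (fun y => u ε (L y)) x‖ ≤
      ‖L‖ ^ k * ‖iteratedFDeriv ℝ k (u ε) (L x)‖ := by
  have ho : IsOpen (L ⁻¹' (Ω' : Set (EuclideanSpace ℝ (Fin d)))) :=
    Ω'.isOpen.preimage L.continuous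
  have h := L.iteratedFDerivWithin_comp_right (hu ε) Ω'.isOpen.uniqueDiffOn ho.uniqueDiffOn hx
    (i := k) (by exact_mod_cast le_top)
  rw [iteratedFDerivWithin_of_isOpen k ho hx, iteratedFDerivWithin_of_isOpen k Ω'.isOpen hx] at h
  change ‖iteratedFDeriv ℝ k (u ε ∘ L) x‖ ≤ _
  rw [h]
  refine (ContinuousMultilinearMap.norm_compContinuousLinearMap_le _ _).trans ?_
  simp [mul_comm]

lemma IsModerate.add (hu : IsSmooth Ω u) (hv : IsSmooth Ω v) (hu' : IsModerate Ω u)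
    (hv' : IsModerate Ω v) : IsModerate Ω (u + v) := by
  intro K hK hKΩ k
  obtain ⟨N, hN⟩ := hu' K hK hKΩ k
  obtain ⟨N', hN'⟩ := hv' K hK hKΩ k
  exact ⟨max N N', ((hN.anti (by omega)).add (hN'.anti (by omega))).le
    fun ε x hx => norm_iteratedFDeriv_add_le hu hv k ε (hKΩ hx)⟩

lemma IsModerate.mul (hu : IsSmooth Ω u) (hv : IsSmooth Ω v) (hu' : IsModerate Ω u)
    (hv' : IsModerate Ω v) : IsModerate Ω (u * v) := by
  intro K hK hKΩ k
  have key := SupIsBigO.sum_of_exists (K := K) (s := Finset.range (k + 1))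
    (Φ := fun i ε x => (k.choose i : ℝ) *
      (‖iteratedFDeriv ℝ i (u ε) x‖ * ‖iteratedFDeriv ℝ (k - i) (v ε) x‖)) ?_
  · obtain ⟨N, hN⟩ := key
    exact ⟨N, hN.le fun ε x hx => norm_iteratedFDeriv_mul_le hu hv k ε (hKΩ hx)⟩
  · intro i _
    obtain ⟨N, hN⟩ := hu' K hK hKΩ i
    obtain ⟨N', hN'⟩ := hv' K hK hKΩ (k - i)
    exact ⟨N + N', ((hN.mul hN' (fun _ _ => norm_nonneg _)
      (fun _ _ => norm_nonneg _)).anti (by push_cast; omega)).const_mul (Nat.cast_nonneg _)⟩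

lemma IsNegligible.add (hu : IsSmooth Ω u) (hv : IsSmooth Ω v) (hu' : IsNegligible Ω u)
    (hv' : IsNegligible Ω v) : IsNegligible Ω (u + v) := fun K hK hKΩ k m =>
  ((hu' K hK hKΩ k m).add (hv' K hK hKΩ k m)).le
    fun ε _ hx => norm_iteratedFDeriv_add_le hu hv k ε (hKΩ hx)

lemma IsNegligible.mul (hu : IsSmooth Ω u) (hv : IsSmooth Ω v) (hu' : IsModerate Ω u)
    (hv' : IsNegligible Ω v) : IsNegligible Ω (u * v) := by
  intro K hK hKΩ k m
  have key := SupIsBigO.sum (K := K) (m := (m : ℤ)) (s := Finset.range (k + 1))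
    (Φ := fun i ε x => (k.choose i : ℝ) *
      (‖iteratedFDeriv ℝ i (u ε) x‖ * ‖iteratedFDeriv ℝ (k - i) (v ε) x‖)) ?_
  · exact key.le fun ε x hx => norm_iteratedFDeriv_mul_le hu hv k ε (hKΩ hx)
  · intro i _
    obtain ⟨N, hN⟩ := hu' K hK hKΩ i
    exact ((hN.mul (hv' K hK hKΩ (k - i) (m + N)) (fun _ _ => norm_nonneg _)
      (fun _ _ => norm_nonneg _)).anti (by push_cast; omega)).const_mul (Nat.cast_nonneg _)

lemma IsModerate.const (c : ℂ) : IsModerate Ω (fun _ _ => c : Net d) := by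
  intro K _ _ k
  refine ⟨0, ‖c‖, 1, one_pos, fun ε _ x _ => ?_⟩
  rcases Nat.eq_zero_or_pos k with rfl | hk
  · simp
  · simp [iteratedFDeriv_const_of_ne hk.ne']

lemma IsSmooth.comp (hu : IsSmooth Ω' u)
    {L : EuclideanSpace ℝ (Fin d) →L[ℝ] EuclideanSpace ℝ (Fin d)} (hL : Set.MapsTo L Ω Ω') :
    IsSmooth Ω (fun ε x => u ε (L x)) := fun ε =>
  (hu ε).comp L.contDiff.contDiffOn hL

lemma IsModerate.comp (hu : IsSmooth Ω' u) (hu' : IsModerate Ω' u)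
    {L : EuclideanSpace ℝ (Fin d) →L[ℝ] EuclideanSpace ℝ (Fin d)} (hL : Set.MapsTo L Ω Ω') :
    IsModerate Ω (fun ε x => u ε (L x)) := by
  intro K hK hKΩ k
  obtain ⟨N, C, η, hη, h⟩ := hu' (L '' K) (hK.image L.continuous)
    (Set.image_subset_iff.2 fun x hx => hL (hKΩ hx)) k
  have h' : SupIsBigO K (fun ε x => ‖iteratedFDeriv ℝ k (u ε) (L x)‖) (-(N : ℤ)) :=
    ⟨C, η, hη, fun ε hε x hx => h ε hε (L x) (Set.mem_image_of_mem L hx)⟩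
  exact ⟨N, (h'.const_mul (pow_nonneg (norm_nonneg L) k)).le
    fun ε x hx => norm_iteratedFDeriv_comp_le hu L k ε (hL (hKΩ hx))⟩

lemma IsNegligible.comp (hu : IsSmooth Ω' u) (hu' : IsNegligible Ω' u)
    {L : EuclideanSpace ℝ (Fin d) →L[ℝ] EuclideanSpace ℝ (Fin d)} (hL : Set.MapsTo L Ω Ω') :
    IsNegligible Ω (fun ε x => u ε (L x)) := by
  intro K hK hKΩ k m
  obtain ⟨C, η, hη, h⟩ := hu' (L '' K) (hK.image L.continuous)
    (Set.image_subset_iff.2 fun x hx => hL (hKΩ hx)) k m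
  have h' : SupIsBigO K (fun ε x => ‖iteratedFDeriv ℝ k (u ε) (L x)‖) (m : ℤ) :=
    ⟨C, η, hη, fun ε hε x hx => h ε hε (L x) (Set.mem_image_of_mem L hx)⟩
  exact (h'.const_mul (pow_nonneg (norm_nonneg L) k)).le
    fun ε x hx => norm_iteratedFDeriv_comp_le hu L k ε (hL (hKΩ hx))

variable (Ω) in
/-- The algebra `E_M(Ω)` of moderate nets of smooth functions on `Ω`. -/
def moderate : Subalgebra ℂ (Net d) where
  carrier := {u | IsSmooth Ω u ∧ IsModerate Ω u}
  add_mem' hu hv := ⟨fun ε => (hu.1 ε).add (hv.1 ε), hu.2.add hu.1 hv.1 hv.2⟩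
  mul_mem' hu hv := ⟨fun ε => (hu.1 ε).mul (hv.1 ε), hu.2.mul hu.1 hv.1 hv.2⟩
  algebraMap_mem' c := ⟨fun _ => contDiffOn_const, IsModerate.const c⟩

variable (Ω) in
/-- The ideal `N(Ω)` of negligible nets in `E_M(Ω)`. -/
def negligible : Ideal (moderate Ω) where
  carrier := {u | IsNegligible Ω (u : Net d)}
  add_mem' {u v} hu hv := IsNegligible.add u.2.1 v.2.1 hu hv
  zero_mem' K _ _ k m := by
    refine SupIsBigO.zero.le fun ε x _ => ?_
    have : ((0 : moderate Ω) : Net d) ε = 0 := rfl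
    simp [this]
  smul_mem' c {u} hu := IsNegligible.mul c.2.1 u.2.1 c.2.2 hu

end

end Colombeau

/-- The special Colombeau algebra `G(Ω) = E_M(Ω) / N(Ω)` of an open set `Ω ⊆ ℝ^d`, a commutative
`ℂ`-algebra. Values of representatives outside `Ω` are irrelevant (`Colombeau.mk_eq_of_eqOn`). -/
abbrev Colombeau {d : ℕ} (Ω : TopologicalSpace.Opens (EuclideanSpace ℝ (Fin d))) : Type :=
  Colombeau.moderate Ω ⧸ Colombeau.negligible Ω

namespace Colombeau

section

variable {d : ℕ} {Ω Ω' : TopologicalSpace.Opens (EuclideanSpace ℝ (Fin d))}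

/-- Nets that agree on `Ω` define the same generalized function on `Ω`. -/
theorem mk_eq_of_eqOn (u v : moderate Ω)
    (h : ∀ ε, Set.EqOn ((u : Net d) ε) ((v : Net d) ε) Ω) :
    Ideal.Quotient.mk (negligible Ω) u = Ideal.Quotient.mk (negligible Ω) v := by
  rw [Ideal.Quotient.eq]
  intro K _ hKΩ k m
  refine SupIsBigO.zero.le fun ε x hx => ?_
  have h0 : ((u - v : moderate Ω) : Net d) ε =ᶠ[nhds x] fun _ => 0 := by
    filter_upwards [Ω.isOpen.mem_nhds (hKΩ hx)] with y hy
    exact sub_eq_zero.2 (h ε hy)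
  have h1 := (h0.iteratedFDeriv (𝕜 := ℝ) k).eq_of_nhds
  rw [h1]
  simp

/-- Composition of nets with a linear map `L : ℝ^d → ℝ^d` sending `Ω` into `Ω'`. -/
def compNet (L : EuclideanSpace ℝ (Fin d) →L[ℝ] EuclideanSpace ℝ (Fin d))
    (hL : Set.MapsTo L Ω Ω') : moderate Ω' →ₐ[ℂ] moderate Ω where
  toFun u := ⟨fun ε x => (u : Net d) ε (L x),
    IsSmooth.comp u.2.1 hL, IsModerate.comp u.2.1 u.2.2 hL⟩
  map_one' := rfl
  map_mul' _ _ := rfl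
  map_zero' := rfl
  map_add' _ _ := rfl
  commutes' _ := rfl

/-- The map `G(Ω') → G(Ω)`, `u ↦ u ∘ L`, for a linear map `L` sending `Ω` into `Ω'`; it is
`[(u_ε)] ↦ [(u_ε ∘ L)]` on representatives. -/
def comp (L : EuclideanSpace ℝ (Fin d) →L[ℝ] EuclideanSpace ℝ (Fin d))
    (hL : Set.MapsTo L Ω Ω') : Colombeau Ω' →ₐ[ℂ] Colombeau Ω :=
  Ideal.quotientMapₐ (negligible Ω) (compNet L hL) fun u hu => IsNegligible.comp u.2.1 hu hL

/-- The restriction map `G(Ω') → G(Ω)` for `Ω ⊆ Ω'`. -/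
def restrict (h : Ω ≤ Ω') : Colombeau Ω' →ₐ[ℂ] Colombeau Ω :=
  comp (ContinuousLinearMap.id ℝ _) fun _ hx => h hx

/-- `Ω` is stable under multiplication by positive real numbers. -/
def IsConic (Ω : TopologicalSpace.Opens (EuclideanSpace ℝ (Fin d))) : Prop :=
  ∀ lam : ℝ, 0 < lam → ∀ x ∈ Ω, lam • x ∈ Ω

/-- The generalized function `u(λ x)`, for a real number `λ > 0`. -/
def dilate (hΩ : IsConic Ω) {lam : ℝ} (hlam : 0 < lam) : Colombeau Ω →ₐ[ℂ] Colombeau Ω :=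
  comp (lam • ContinuousLinearMap.id ℝ _) fun x hx => hΩ lam hlam x hx

/-- `u ∈ G(Ω)` is homogeneous of degree `α`: for each `λ > 0`, `u(λ x) = λ^α u(x)` in `G(Ω)`. -/
def IsHomogeneous (hΩ : IsConic Ω) (α : ℝ) (u : Colombeau Ω) : Prop :=
  ∀ (lam : ℝ) (hlam : 0 < lam), dilate hΩ hlam u = ((lam ^ α : ℝ) : ℂ) • u

end

/-- The open set `ℝ^d ∖ {0}`. -/
def punctured (d : ℕ) : TopologicalSpace.Opens (EuclideanSpace ℝ (Fin d)) :=
  ⟨{0}ᶜ, isOpen_compl_singleton⟩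

theorem isConic_top (d : ℕ) :
    IsConic (⊤ : TopologicalSpace.Opens (EuclideanSpace ℝ (Fin d))) :=
  fun _ _ _ _ => trivial

theorem isConic_punctured (d : ℕ) : IsConic (punctured d) :=
  fun _ hlam _ hx => smul_ne_zero hlam.ne' hx

/-- `u ∈ G(ℝ^d ∖ {0})` is extendable: it is the restriction of some `û ∈ G(ℝ^d)`. -/
def IsExtendable {d : ℕ} (u : Colombeau (punctured d)) : Prop :=
  ∃ v : Colombeau (⊤ : TopologicalSpace.Opens (EuclideanSpace ℝ (Fin d))), restrict (Ω := punctured d) le_top v = u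

/-- `u ∈ G(ℝ^d ∖ {0})` is extendable as a homogeneous function: it is the restriction of some
`û ∈ G(ℝ^d)` that is homogeneous of some degree `β ∈ ℝ`. -/
def IsExtendableAsHomogeneous {d : ℕ} (u : Colombeau (punctured d)) : Prop :=
  ∃ β : ℝ, ∃ v : Colombeau (⊤ : TopologicalSpace.Opens (EuclideanSpace ℝ (Fin d))),
    IsHomogeneous (isConic_top d) β v ∧ restrict (Ω := punctured d) le_top v = u

end Colombeau

namespace Colombeau

/-! Extension: moderateness controls `u_ε` only on fixed compact sets, so `u_ε` cannot be used
arbitrarily close to the origin. Homogeneity permits replacing it on the `k`-th dyadic shell by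
`2^(-kα) u_ε(2^k x)`, which reads `u_ε` on one fixed shell. With a cutoff `χ` and `ψ = χ - χ(2 ·)`,
the extension is `(1 - χ) u_ε` plus the sum over `k < L(ε)` of `ψ(2^k x) 2^(-kα) u_ε(2^k x)`. Taking
`L(ε)` of order `log₂(1/ε)` keeps the sum moderate (`dyadicSum_mem_moderate`). A compact set
avoiding `0` meets finitely many shells, independently of `ε`, so there the difference from `u` is a
fixed finite sum of negligible errors.

Degree: a nonzero restriction forces `β = α`. On the whole space, differentiating homogeneity for `λ
= 1/2` gives `2^(-k) D^k v(x/2) ≈ 2^(-β) D^k v(x)`. For `k > β` this is a contraction, so `D^k v` is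
negligible on balls; at `0` it makes `D^k v(0)` negligible whenever `k ≠ β`. If `β ∉ ℕ`, descending
from large `k` with the mean value inequality yields `v = 0` (`isNegligible_of_degree_ne`). -/

variable {d : ℕ} {Ω : TopologicalSpace.Opens (EuclideanSpace ℝ (Fin d))}

/-! ### Homogeneity on representatives, degree and restriction. -/

theorem isNegligible_of_isHomogeneous {hΩ : IsConic Ω} {α : ℝ} {u : moderate Ω}
    (h : IsHomogeneous hΩ α (Ideal.Quotient.mk (negligible Ω) u)) {lam : ℝ} (hlam : 0 < lam) :
    IsNegligible Ω (fun ε x => (u : Net d) ε (lam • x) - lam ^ α • (u : Net d) ε x) := by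
  have h1 : Ideal.Quotient.mk (negligible Ω)
      (compNet (lam • ContinuousLinearMap.id ℝ _) (fun x hx => hΩ lam hlam x hx) u) =
      Ideal.Quotient.mk (negligible Ω) (((lam ^ α : ℝ) : ℂ) • u) := h lam hlam
  rw [Ideal.Quotient.eq] at h1
  have h2 : IsNegligible Ω (fun ε x => (u : Net d) ε (lam • x) -
    ((lam ^ α : ℝ) : ℂ) * (u : Net d) ε x) := h1
  simpa only [Complex.real_smul] using h2

/-- Homogeneous generalized functions of two different degrees coincide only if they vanish. -/
theorem IsHomogeneous.degree_unique {hΩ : IsConic Ω} {α β : ℝ} {u : Colombeau Ω} (hu : u ≠ 0)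
    (hα : IsHomogeneous hΩ α u) (hβ : IsHomogeneous hΩ β u) : α = β := by
  have h := (hα 2 two_pos).symm.trans (hβ 2 two_pos)
  rw [← sub_eq_zero, ← sub_smul] at h
  have h1 : ((2 ^ α : ℝ) : ℂ) - ((2 ^ β : ℝ) : ℂ) = 0 := by
    by_contra h0
    refine hu ?_
    have := congrArg (fun w => (((2 ^ α : ℝ) : ℂ) - ((2 ^ β : ℝ) : ℂ))⁻¹ • w) h
    simpa only [smul_smul, inv_mul_cancel₀ h0, one_smul, smul_zero] using this
  have h2 : (2 : ℝ) ^ α = 2 ^ β := by exact_mod_cast sub_eq_zero.1 h1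
  exact (Real.strictMono_rpow_of_base_gt_one one_lt_two).injective h2

theorem IsHomogeneous.restrict {Ω' : TopologicalSpace.Opens (EuclideanSpace ℝ (Fin d))}
    {hΩ : IsConic Ω} {hΩ' : IsConic Ω'} (hle : Ω ≤ Ω') {α : ℝ} {u : Colombeau Ω'}
    (hu : IsHomogeneous hΩ' α u) : IsHomogeneous hΩ α (restrict hle u) := by
  intro lam hlam
  have h := congrArg (Colombeau.restrict hle) (hu lam hlam)
  rw [show Colombeau.restrict hle (((lam ^ α : ℝ) : ℂ) • u) = ((lam ^ α : ℝ) : ℂ) • Colombeau.restrict hle u from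
    (Colombeau.restrict hle).toLinearMap.map_smul _ u] at h
  rw [← h]
  clear h
  obtain ⟨u, rfl⟩ := Ideal.Quotient.mk_surjective u
  rfl

theorem iteratedFDeriv_comp_smul_sub {E F : Type*} [NormedAddCommGroup E] [NormedSpace ℝ E]
    [NormedAddCommGroup F] [NormedSpace ℝ F] {f : E → F} (hf : ContDiff ℝ ∞ f) (a c : ℝ) (k : ℕ)
    (x : E) :
    iteratedFDeriv ℝ k (fun y => f (a • y) - c • f y) x =
      a ^ k • iteratedFDeriv ℝ k f (a • x) - c • iteratedFDeriv ℝ k f x := by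
  have hk : ContDiff ℝ k f := hf.of_le (by exact_mod_cast le_top)
  rw [fun_iteratedFDeriv_sub_apply (f := fun y => f (a • y)) (g := fun y => c • f y)
    (hk.comp (contDiff_const_smul a)).contDiffAt (contDiff_const.smul hk).contDiffAt, iteratedFDeriv_comp_const_smul a hk,
    iteratedFDeriv_const_smul_apply' hk.contDiffAt]

/-! ### Homogeneous generalized functions on the whole space. -/

section HomogeneousOnSpace

variable {u : Net d}

/-- Balls centred at the origin are convex and stable under halving, as the contraction and mean
value arguments require. -/
theorem isNegligible_top_of_closedBall
    (h : ∀ (R : ℝ) (k m : ℕ), SupIsBigO (Metric.closedBall (0 : EuclideanSpace ℝ (Fin d)) R)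
      (fun ε x => ‖iteratedFDeriv ℝ k (u ε) x‖) m) : IsNegligible ⊤ u := by
  intro K hK _ k m
  obtain ⟨R, hR⟩ := hK.isBounded.subset_closedBall 0
  obtain ⟨C, η, hη, hC⟩ := h R k m
  exact ⟨C, η, hη, fun ε hε x hx => hC ε hε x (hR hx)⟩

/-- The derivatives of high order of a homogeneous net are negligible: halving the argument
contracts them. -/
theorem iteratedFDeriv_isBigO_of_degree_lt (hu : ∀ ε, ContDiff ℝ ∞ (u ε)) {β : ℝ}
    (h : IsNegligible ⊤ (fun ε x => u ε ((1 / 2 : ℝ) • x) - (1 / 2 : ℝ) ^ β • u ε x))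
    {k : ℕ} (hk : β < k) (R : ℝ) (m : ℕ) :
    SupIsBigO (Metric.closedBall (0 : EuclideanSpace ℝ (Fin d)) R)
      (fun ε x => ‖iteratedFDeriv ℝ k (u ε) x‖) m := by
  obtain ⟨C, η, hη, hC⟩ := h (Metric.closedBall 0 R) (isCompact_closedBall 0 R)
    (fun _ _ => trivial) k m
  have hlt : (1 / 2 : ℝ) ^ k < (1 / 2 : ℝ) ^ β := by
    rw [← Real.rpow_natCast]
    exact Real.rpow_lt_rpow_of_exponent_gt (by norm_num) (by norm_num) hk
  have hpos : 0 < (1 / 2 : ℝ) ^ β - (1 / 2 : ℝ) ^ k := sub_pos.2 hlt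
  refine ⟨C / ((1 / 2 : ℝ) ^ β - (1 / 2 : ℝ) ^ k), η, hη, fun ε hε x hx => ?_⟩
  have hcont : Continuous fun y => ‖iteratedFDeriv ℝ k (u ε) y‖ :=
    ((hu ε).continuous_iteratedFDeriv (by exact_mod_cast le_top)).norm
  -- At a maximum point `y` the value at `y / 2` is no larger, so the term with factor `2^(-k)` is
  -- absorbed into the one with the larger factor `2^(-β)`.
  obtain ⟨y, hy, hmax⟩ := (isCompact_closedBall (0 : EuclideanSpace ℝ (Fin d)) R).exists_isMaxOn
    ⟨x, hx⟩ hcont.continuousOn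
  refine (hmax hx).trans ?_
  rw [div_mul_eq_mul_div, le_div_iff₀ hpos]
  have hy2 : (1 / 2 : ℝ) • y ∈ Metric.closedBall (0 : EuclideanSpace ℝ (Fin d)) R := by
    rw [mem_closedBall_zero_iff] at hy ⊢
    rw [norm_smul]
    have := norm_nonneg y
    norm_num
    linarith
  have h1 := hC ε hε y hy
  beta_reduce at h1 ⊢
  rw [iteratedFDeriv_comp_smul_sub (hu ε)] at h1
  have h2 := norm_sub_norm_le ((1 / 2 : ℝ) ^ β • iteratedFDeriv ℝ k (u ε) y)
    ((1 / 2 : ℝ) ^ k • iteratedFDeriv ℝ k (u ε) ((1 / 2 : ℝ) • y))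
  rw [norm_sub_rev, norm_smul, norm_smul, Real.norm_of_nonneg (by positivity),
    Real.norm_of_nonneg (by positivity)] at h2
  have h3 : ‖iteratedFDeriv ℝ k (u ε) ((1 / 2 : ℝ) • y)‖ ≤ ‖iteratedFDeriv ℝ k (u ε) y‖ :=
    hmax hy2
  have h4 := mul_le_mul_of_nonneg_left h3 (by positivity : (0 : ℝ) ≤ (1 / 2 : ℝ) ^ k)
  linarith

/-- The derivatives at the origin of a homogeneous net are negligible, except for those whose order
is the degree. -/
theorem iteratedFDeriv_zero_isBigO_of_degree_ne (hu : ∀ ε, ContDiff ℝ ∞ (u ε)) {β : ℝ}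
    (h : IsNegligible ⊤ (fun ε x => u ε ((1 / 2 : ℝ) • x) - (1 / 2 : ℝ) ^ β • u ε x))
    {k : ℕ} (hk : β ≠ k) (m : ℕ) :
    SupIsBigO {(0 : EuclideanSpace ℝ (Fin d))} (fun ε x => ‖iteratedFDeriv ℝ k (u ε) x‖) m := by
  obtain ⟨C, η, hη, hC⟩ := h {0} isCompact_singleton (fun _ _ => trivial) k m
  have hne : (1 / 2 : ℝ) ^ k - (1 / 2 : ℝ) ^ β ≠ 0 := by
    rw [sub_ne_zero, ← Real.rpow_natCast]
    exact fun h => hk ((Real.strictAnti_rpow_of_base_lt_one (by norm_num)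
      (by norm_num)).injective h.symm)
  refine ⟨C / |(1 / 2 : ℝ) ^ k - (1 / 2 : ℝ) ^ β|, η, hη, fun ε hε x hx => ?_⟩
  obtain rfl : x = 0 := hx
  -- The origin is fixed by the dilation, so both terms are multiples of the same derivative.
  have h1 := hC ε hε 0 rfl
  beta_reduce at h1 ⊢
  rw [iteratedFDeriv_comp_smul_sub (hu ε), smul_zero, ← sub_smul, norm_smul,
    Real.norm_eq_abs] at h1
  rw [div_mul_eq_mul_div, le_div_iff₀ (abs_pos.2 hne)]
  linarith

/-- Mean value inequality on the segment from the origin: the next derivative bounds the variation,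
at the cost of a factor `R`. -/
theorem iteratedFDeriv_isBigO_of_succ (hu : ∀ ε, ContDiff ℝ ∞ (u ε)) {R : ℝ} {k m : ℕ}
    (h0 : SupIsBigO {(0 : EuclideanSpace ℝ (Fin d))} (fun ε x => ‖iteratedFDeriv ℝ k (u ε) x‖) m)
    (h1 : SupIsBigO (Metric.closedBall (0 : EuclideanSpace ℝ (Fin d)) R)
      (fun ε x => ‖iteratedFDeriv ℝ (k + 1) (u ε) x‖) m) :
    SupIsBigO (Metric.closedBall (0 : EuclideanSpace ℝ (Fin d)) R)
      (fun ε x => ‖iteratedFDeriv ℝ k (u ε) x‖) m := by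
  obtain ⟨C, η, hη, hC⟩ := h0
  obtain ⟨C', η', hη', hC'⟩ := h1
  refine ⟨C + C' * R, min η η', lt_min hη hη', fun ε hε x hx => ?_⟩
  have hxR := mem_closedBall_zero_iff.1 hx
  have hC0 := hC ε (hε.trans_le (min_le_left _ _)) 0 rfl
  have hC1 := hC' ε (hε.trans_le (min_le_right _ _))
  have hmv := (convex_closedBall (0 : EuclideanSpace ℝ (Fin d)) R).norm_image_sub_le_of_norm_fderiv_le
    (𝕜 := ℝ) (f := iteratedFDeriv ℝ k (u ε)) (C := C' * (ε : ℝ) ^ (m : ℤ)) (x := 0) (y := x)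
    (fun y _ => ((hu ε).differentiable_iteratedFDeriv
      (by exact_mod_cast WithTop.coe_lt_top _)).differentiableAt)
    (fun y hy => by rw [norm_fderiv_iteratedFDeriv]; exact hC1 y hy)
    (Metric.mem_closedBall_self ((norm_nonneg x).trans hxR)) hx
  rw [sub_zero] at hmv
  have h2 := norm_sub_norm_le (iteratedFDeriv ℝ k (u ε) x) (iteratedFDeriv ℝ k (u ε) 0)
  have h3 : 0 ≤ C' * (ε : ℝ) ^ (m : ℤ) := (norm_nonneg _).trans (hC1 x hx)
  have h4 := mul_le_mul_of_nonneg_left hxR h3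
  linarith

/-- Descending induction on `k`, starting at any order `n > β`; each step down needs only the
derivative at the origin, which is negligible since `β ≠ k`. -/
theorem isNegligible_of_degree_ne (hu : ∀ ε, ContDiff ℝ ∞ (u ε)) {β : ℝ}
    (h : IsNegligible ⊤ (fun ε x => u ε ((1 / 2 : ℝ) • x) - (1 / 2 : ℝ) ^ β • u ε x))
    (hβ : ∀ n : ℕ, β ≠ n) : IsNegligible ⊤ u := by
  refine isNegligible_top_of_closedBall fun R k m => ?_
  obtain ⟨n, hn⟩ := exists_nat_gt β
  induction hj : n - k generalizing k with
  | zero =>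
    have hnk : (n : ℝ) ≤ k := by exact_mod_cast Nat.sub_eq_zero_iff_le.1 hj
    exact iteratedFDeriv_isBigO_of_degree_lt hu h (hn.trans_le hnk) R m
  | succ j ih =>
    exact iteratedFDeriv_isBigO_of_succ hu (iteratedFDeriv_zero_isBigO_of_degree_ne hu h (hβ k) m)
      (ih (k + 1) (by omega))

end HomogeneousOnSpace

theorem IsHomogeneous.eq_natCast
    {v : Colombeau (⊤ : TopologicalSpace.Opens (EuclideanSpace ℝ (Fin d)))} {β : ℝ} (hv : v ≠ 0)
    (h : IsHomogeneous (isConic_top d) β v) : ∃ n : ℕ, β = n := by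
  by_contra! hβ
  obtain ⟨v, rfl⟩ := Ideal.Quotient.mk_surjective v
  refine hv (Ideal.Quotient.eq_zero_iff_mem.2 ?_)
  exact isNegligible_of_degree_ne (fun ε => contDiffOn_univ.1 (v.2.1 ε))
    (isNegligible_of_isHomogeneous h (by norm_num)) hβ

theorem IsExtendableAsHomogeneous.degree_eq_natCast {u : Colombeau (punctured d)} (hu : u ≠ 0)
    {α : ℝ} (hα : IsHomogeneous (isConic_punctured d) α u) (h : IsExtendableAsHomogeneous u) :
    ∃ n : ℕ, α = n := by
  obtain ⟨β, v, hv, rfl⟩ := h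
  obtain rfl : α = β := hα.degree_unique hu (hv.restrict le_top)
  exact hv.eq_natCast fun h0 => hu (by rw [h0]; rfl)

/-! ### Extension across the origin by dyadic rescaling. -/

theorem SupIsBigO.union {X : Type*} {K K' : Set X} {φ : Set.Ioc (0 : ℝ) 1 → X → ℝ} {m : ℤ}
    (h : SupIsBigO K φ m) (h' : SupIsBigO K' φ m) : SupIsBigO (K ∪ K') φ m := by
  obtain ⟨C, η, hη, h⟩ := h
  obtain ⟨C', η', hη', h'⟩ := h'
  refine ⟨max C C', min η η', lt_min hη hη', fun ε hε x hx => ?_⟩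
  have h0 : (0 : ℝ) ≤ (ε : ℝ) ^ m := (zpow_pos ε.2.1 m).le
  rcases hx with hx | hx
  · exact (h ε (hε.trans_le (min_le_left _ _)) x hx).trans
      (mul_le_mul_of_nonneg_right (le_max_left _ _) h0)
  · exact (h' ε (hε.trans_le (min_le_right _ _)) x hx).trans
      (mul_le_mul_of_nonneg_right (le_max_right _ _) h0)

theorem isModerate_of_contDiff {f : EuclideanSpace ℝ (Fin d) → ℂ} (hf : ContDiff ℝ ∞ f) :
    IsModerate Ω (fun _ => f) := by
  intro K hK _ k
  obtain ⟨C, hC⟩ := hK.exists_bound_of_continuousOn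
    (hf.continuous_iteratedFDeriv (m := k) (by exact_mod_cast le_top)).continuousOn
  exact ⟨0, C, 1, one_pos, fun ε _ x hx => by simpa using hC x hx⟩

/-- The constant net of a smooth function, as a moderate net. -/
def constNet (f : EuclideanSpace ℝ (Fin d) → ℂ) (hf : ContDiff ℝ ∞ f) : moderate Ω :=
  ⟨fun _ => f, fun _ => hf.contDiffOn, isModerate_of_contDiff hf⟩

/-- A moderate net on `ℝ^d ∖ {0}` becomes a moderate net on `ℝ^d` after multiplication with a smooth
function vanishing near the origin. -/
theorem mul_mem_moderate_top {f : EuclideanSpace ℝ (Fin d) → ℂ} (hf : ContDiff ℝ ∞ f) {r : ℝ}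
    (hr : 0 < r) (hf0 : ∀ x, ‖x‖ < r → f x = 0) (u : moderate (punctured d)) :
    (fun ε x => f x * (u : Net d) ε x) ∈ moderate
      (⊤ : TopologicalSpace.Opens (EuclideanSpace ℝ (Fin d))) := by
  have hz : ∀ (ε : Set.Ioc (0 : ℝ) 1) (x : EuclideanSpace ℝ (Fin d)), ‖x‖ < r →
      (fun y => f y * (u : Net d) ε y) =ᶠ[nhds x] fun _ => 0 := by
    intro ε x hx
    filter_upwards [(isOpen_lt continuous_norm continuous_const).mem_nhds hx] with y hy
    rw [hf0 y hy, zero_mul]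
  have hfu := ((constNet f hf : moderate (punctured d)) * u).2
  constructor
  · intro ε x _
    refine ContDiffAt.contDiffWithinAt ?_
    by_cases hx : x = 0
    · exact contDiffAt_const.congr_of_eventuallyEq (hz ε x (by simpa [hx] using hr))
    · exact (hfu.1 ε).contDiffAt ((punctured d).isOpen.mem_nhds hx)
  · intro K hK _ k
    have hK' : IsCompact (K ∩ {x | r ≤ ‖x‖}) :=
      hK.inter_right (isClosed_le continuous_const continuous_norm)
    obtain ⟨N, hN⟩ := hfu.2 _ hK' (by
      rintro x ⟨_, hx⟩ rfl
      exact hr.not_ge (by simpa using hx)) k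
    refine ⟨N, ?_⟩
    have h0 : SupIsBigO {x | ‖x‖ < r} (fun ε x =>
        ‖iteratedFDeriv ℝ k (fun y => f y * (u : Net d) ε y) x‖) (-(N : ℤ)) := by
      refine SupIsBigO.zero.le fun ε x hx => ?_
      rw [((hz ε x hx).iteratedFDeriv (𝕜 := ℝ) k).eq_of_nhds]
      simp
    obtain ⟨C, η, hη, hC⟩ := SupIsBigO.union hN h0
    refine ⟨C, η, hη, fun ε hε x hx => hC ε hε x ?_⟩
    rcases lt_or_ge ‖x‖ r with h | h
    · exact Or.inr h
    · exact Or.inl ⟨hx, h⟩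

/-- If `w` is a moderate net on `ℝ^d` with supports in a fixed ball, then the sum of `L(ε)` dyadic
rescalings of `w`, with power weights, is moderate as soon as `2^(L(ε)) ≤ 1/ε`. -/
theorem dyadicSum_mem_moderate
    (w : moderate (⊤ : TopologicalSpace.Opens (EuclideanSpace ℝ (Fin d)))) {R : ℝ}
    (hw : ∀ ε x, R < ‖x‖ → (w : Net d) ε x = 0) (α : ℝ) (L : Set.Ioc (0 : ℝ) 1 → ℕ)
    (hL : ∀ ε, (2 : ℝ) ^ L ε ≤ 1 / ε) :
    (fun ε x => ∑ k ∈ Finset.range (L ε), ((2 : ℝ) ^ k) ^ (-α) •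
      (w : Net d) ε ((2 : ℝ) ^ k • x)) ∈
      moderate (⊤ : TopologicalSpace.Opens (EuclideanSpace ℝ (Fin d))) := by
  have hws : ∀ ε, ContDiff ℝ ∞ ((w : Net d) ε) := fun ε => contDiffOn_univ.1 (w.2.1 ε)
  have hterm : ∀ ε (k : ℕ), ContDiff ℝ ∞
      (fun x => ((2 : ℝ) ^ k) ^ (-α) • (w : Net d) ε ((2 : ℝ) ^ k • x)) := fun ε k =>
    (contDiff_const_smul (((2 : ℝ) ^ k) ^ (-α))).comp ((hws ε).comp (contDiff_const_smul _))
  refine ⟨fun ε => (ContDiff.sum fun k _ => hterm ε k).contDiffOn, fun K _ _ j => ?_⟩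
  obtain ⟨N, C, η, hη, hC⟩ := w.2.2 (Metric.closedBall 0 R) (isCompact_closedBall 0 R)
    (fun _ _ => trivial) j
  obtain ⟨M, hM⟩ := exists_nat_ge (-α)
  -- The exponent collects `1` for the number of terms, `M` for the weights, `j` for the chain rule
  -- and `N` for the moderateness of `w`.
  refine ⟨1 + M + j + N, |C|, η, hη, fun ε hε x _ => ?_⟩
  have hε0 : (0 : ℝ) < ε := ε.2.1
  have hbound : ∀ y, ‖iteratedFDeriv ℝ j ((w : Net d) ε) y‖ ≤ |C| * (ε : ℝ) ^ (-(N : ℤ)) := by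
    intro y
    rcases le_or_gt ‖y‖ R with hy | hy
    · exact (hC ε hε y (mem_closedBall_zero_iff.2 hy)).trans
        (mul_le_mul_of_nonneg_right (le_abs_self C) (zpow_pos hε0 _).le)
    · have h0 : (w : Net d) ε =ᶠ[nhds y] fun _ => 0 := by
        filter_upwards [(isOpen_lt continuous_const continuous_norm).mem_nhds hy] with z hz
        exact hw ε z hz
      rw [(h0.iteratedFDeriv (𝕜 := ℝ) j).eq_of_nhds]
      have := mul_nonneg (abs_nonneg C) (zpow_pos hε0 (-(N : ℤ))).le
      simpa using this
  have hstep : ∀ k ∈ Finset.range (L ε), ‖iteratedFDeriv ℝ j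
      (fun x => ((2 : ℝ) ^ k) ^ (-α) • (w : Net d) ε ((2 : ℝ) ^ k • x)) x‖ ≤
      (1 / (ε : ℝ)) ^ (M + j) * (|C| * (ε : ℝ) ^ (-(N : ℤ))) := by
    intro k hk
    have hj : ContDiff ℝ j ((w : Net d) ε) := (hws ε).of_le (by exact_mod_cast le_top)
    have h1 : (1 : ℝ) ≤ 2 ^ k := one_le_pow₀ one_le_two
    have h2 : (2 : ℝ) ^ k ≤ 1 / ε :=
      (pow_le_pow_right₀ one_le_two (Finset.mem_range.1 hk).le).trans (hL ε)
    have h3 : ((2 : ℝ) ^ k) ^ (-α) ≤ (1 / (ε : ℝ)) ^ M :=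
      calc ((2 : ℝ) ^ k) ^ (-α) ≤ ((2 : ℝ) ^ k) ^ (M : ℝ) := Real.rpow_le_rpow_of_exponent_le h1 hM
        _ = ((2 : ℝ) ^ k) ^ M := Real.rpow_natCast _ _
        _ ≤ _ := pow_le_pow_left₀ (by positivity) h2 M
    rw [iteratedFDeriv_const_smul_apply' (f := fun x => (w : Net d) ε ((2 : ℝ) ^ k • x))
      (hj.comp (contDiff_const_smul _)).contDiffAt, iteratedFDeriv_comp_const_smul _ hj,
      norm_smul, norm_smul, Real.norm_of_nonneg (by positivity), Real.norm_of_nonneg (by positivity),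
      ← mul_assoc, pow_add]
    gcongr
    exact hbound _
  beta_reduce
  rw [iteratedFDeriv_fun_sum_apply fun k _ =>
    ((hterm ε k).of_le (by exact_mod_cast le_top)).contDiffAt]
  calc _ ≤ ∑ k ∈ Finset.range (L ε), (1 / (ε : ℝ)) ^ (M + j) * (|C| * (ε : ℝ) ^ (-(N : ℤ))) :=
        norm_sum_le_of_le _ hstep
    _ = L ε * ((1 / (ε : ℝ)) ^ (M + j) * (|C| * (ε : ℝ) ^ (-(N : ℤ)))) := by
        rw [Finset.sum_const, Finset.card_range, nsmul_eq_mul]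
    _ ≤ (1 / (ε : ℝ)) * ((1 / (ε : ℝ)) ^ (M + j) * (|C| * (ε : ℝ) ^ (-(N : ℤ)))) := by
        gcongr
        refine le_trans ?_ (hL ε)
        exact_mod_cast Nat.lt_two_pow_self.le
    _ = |C| * (ε : ℝ) ^ (-((1 + M + j + N : ℕ) : ℤ)) := by
        simp only [zpow_neg, zpow_natCast, one_div, inv_pow, pow_add, mul_inv, pow_one]
        ring

/-- Homogeneous generalized functions on `ℝ^d ∖ {0}` extend to `ℝ^d`. -/
theorem IsHomogeneous.isExtendable {u : Colombeau (punctured d)} {α : ℝ}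
    (hα : IsHomogeneous (isConic_punctured d) α u) : IsExtendable u := by
  obtain ⟨u, rfl⟩ := Ideal.Quotient.mk_surjective u
  let b : ContDiffBump (0 : EuclideanSpace ℝ (Fin d)) := ⟨1, 2, one_pos, one_lt_two⟩
  let χ : EuclideanSpace ℝ (Fin d) → ℂ := fun x => (b x : ℂ)
  have hχ : ContDiff ℝ ∞ χ := Complex.ofRealCLM.contDiff.comp b.contDiff
  have hχ1 : ∀ x, ‖x‖ ≤ 1 → χ x = 1 := fun x hx => by
    simp [χ, b.one_of_mem_closedBall (mem_closedBall_zero_iff.2 hx)]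
  have hχ2 : ∀ x, 2 ≤ ‖x‖ → χ x = 0 := fun x hx => by
    simp [χ, b.zero_of_le_dist (x := x) (by simpa using hx)]
  let ψ : EuclideanSpace ℝ (Fin d) → ℂ := fun x => χ x - χ ((2 : ℝ) • x)
  have hψ : ContDiff ℝ ∞ ψ := hχ.sub (hχ.comp (contDiff_const_smul _))
  have hψ0 : ∀ x, ‖x‖ < 1 / 2 → ψ x = 0 := fun x hx => by
    have : ‖(2 : ℝ) • x‖ ≤ 1 := by rw [norm_smul, Real.norm_two]; linarith
    simp only [ψ]
    rw [hχ1 x (by linarith), hχ1 _ this, sub_self]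
  have hψ2 : ∀ x, 2 ≤ ‖x‖ → ψ x = 0 := fun x hx => by
    have : 2 ≤ ‖(2 : ℝ) • x‖ := by rw [norm_smul, Real.norm_two]; linarith
    simp only [ψ]
    rw [hχ2 x hx, hχ2 _ this, sub_self]
  have hψs : ∀ (n : ℕ) (x), ∑ k ∈ Finset.range n, ψ ((2 : ℝ) ^ k • x) =
      χ x - χ ((2 : ℝ) ^ n • x) := fun n x => by
    simp only [ψ, smul_smul, ← pow_succ']
    rw [Finset.sum_range_sub' fun k => χ ((2 : ℝ) ^ k • x)]
    simp
  -- `L ε` is the integer part of `log₂(1/ε)`: the lower bound on `1/ε` gives moderateness, the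
  -- upper one ensures that `L ε` eventually exceeds any fixed `n`.
  choose L hL using fun ε : Set.Ioc (0 : ℝ) 1 =>
    exists_nat_pow_near ((one_le_div ε.2.1).2 ε.2.2) (one_lt_two (α := ℝ))
  let w : moderate ⊤ := ⟨_, mul_mem_moderate_top hψ one_half_pos hψ0 u⟩
  let v₀ : moderate ⊤ := ⟨_, mul_mem_moderate_top (contDiff_const.sub hχ) one_pos
    (fun x hx => sub_eq_zero.2 (hχ1 x hx.le).symm) u⟩
  let v₁ : moderate ⊤ := ⟨_, dyadicSum_mem_moderate w (R := 2)
    (fun ε x hx => by simp [w, hψ2 x hx.le]) α L fun ε => (hL ε).1⟩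
  refine ⟨Ideal.Quotient.mk _ (v₀ + v₁), ?_⟩
  change Ideal.Quotient.mk (negligible (punctured d))
    (compNet (ContinuousLinearMap.id ℝ _) (fun x _ => Set.mem_univ x) (v₀ + v₁)) = _
  rw [Ideal.Quotient.eq]
  -- Negligibility holds for each fixed `n`; no uniformity in `n` is needed, since `n` will depend
  -- only on `K`.
  have hneg : ∀ n : ℕ, IsNegligible (punctured d) (fun ε x => ∑ k ∈ Finset.range n,
      ψ ((2 : ℝ) ^ k • x) * (((2 : ℝ) ^ k) ^ (-α) • (u : Net d) ε ((2 : ℝ) ^ k • x) -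
        (u : Net d) ε x)) := by
    intro n
    have hmem : ∑ k ∈ Finset.range n, constNet (fun x => ψ ((2 : ℝ) ^ k • x) *
        (((2 : ℝ) ^ k) ^ (-α) : ℝ)) ((hψ.comp (contDiff_const_smul _)).mul contDiff_const) *
        (compNet ((2 : ℝ) ^ k • ContinuousLinearMap.id ℝ _)
          (fun x hx => isConic_punctured d _ (by positivity) x hx) u -
          ((((2 : ℝ) ^ k) ^ α : ℝ) : ℂ) • u) ∈ negligible (punctured d) :=
      Ideal.sum_mem _ fun k _ => Ideal.mul_mem_left _ _
        (Ideal.Quotient.eq.1 (hα ((2 : ℝ) ^ k) (by positivity)))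
    refine Eq.mp (congrArg (IsNegligible (punctured d)) ?_) hmem
    funext ε x
    rw [AddSubmonoidClass.coe_finsetSum, Finset.sum_apply, Finset.sum_apply]
    refine Finset.sum_congr rfl fun k _ => ?_
    have hc : ((((2 : ℝ) ^ k) ^ (-α) : ℝ) : ℂ) * ((((2 : ℝ) ^ k) ^ α : ℝ) : ℂ) = 1 := by
      rw [← Complex.ofReal_mul, ← Real.rpow_add (by positivity), neg_add_cancel, Real.rpow_zero,
        Complex.ofReal_one]
    change ψ ((2 : ℝ) ^ k • x) * ((((2 : ℝ) ^ k) ^ (-α) : ℝ) : ℂ) *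
      ((u : Net d) ε ((2 : ℝ) ^ k • x) - ((((2 : ℝ) ^ k) ^ α : ℝ) : ℂ) * (u : Net d) ε x) = _
    rw [Complex.real_smul]
    linear_combination (-ψ ((2 : ℝ) ^ k • x) * (u : Net d) ε x) * hc
  intro K hK hKΩ j m
  obtain ⟨r, hr, hrK⟩ : ∃ r : ℝ, 0 < r ∧ ∀ x ∈ K, r < ‖x‖ := by
    have h0 : (0 : EuclideanSpace ℝ (Fin d)) ∈ Kᶜ := fun h => hKΩ h rfl
    obtain ⟨r, hr, hball⟩ := Metric.isOpen_iff.1 hK.isClosed.isOpen_compl 0 h0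
    refine ⟨r / 2, half_pos hr, fun x hx => ?_⟩
    by_contra! hlt
    exact hball (mem_ball_zero_iff.2 (by linarith)) hx
  -- From `k = n` on, the dilates by `2^k` push `K` out of the support of `ψ` and `χ`.
  obtain ⟨n, hn⟩ := pow_unbounded_of_one_lt (2 / r) (one_lt_two (α := ℝ))
  have hbig : ∀ k, n ≤ k → ∀ x : EuclideanSpace ℝ (Fin d), r < ‖x‖ → 2 ≤ ‖(2 : ℝ) ^ k • x‖ := by
    intro k hk x hx
    rw [norm_smul, Real.norm_of_nonneg (by positivity)]
    have h1 : (2 : ℝ) ^ n ≤ 2 ^ k := pow_le_pow_right₀ one_le_two hk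
    rw [div_lt_iff₀ hr] at hn
    exact hn.le.trans (mul_le_mul h1 hx.le hr.le (by positivity))
  obtain ⟨C, η, hη, hC⟩ := hneg n K hK hKΩ j m
  refine ⟨C, min η (1 / 2 ^ (n + 1)), lt_min hη (by positivity), fun ε hε x hx => ?_⟩
  have hLn : n ≤ L ε := by
    have h1 : (ε : ℝ) < 1 / 2 ^ (n + 1) := hε.trans_le (min_le_right _ _)
    have h2 : (2 : ℝ) ^ (n + 1) < 2 ^ (L ε + 1) :=
      ((lt_one_div ε.2.1 (by positivity)).1 h1).trans (hL ε).2
    have := (pow_lt_pow_iff_right₀ (one_lt_two (α := ℝ))).1 h2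
    omega
  refine le_trans (le_of_eq ?_) (hC ε (hε.trans_le (min_le_left _ _)) x hx)
  refine congrArg norm (Filter.EventuallyEq.iteratedFDeriv (𝕜 := ℝ) ?_ j).eq_of_nhds
  -- Derivatives are compared, so the identity is needed near `x`. Where `r < ‖y‖`, the terms with
  -- `k ≥ n` vanish and the remaining values of `ψ` telescope to `χ y`, completing `1 - χ y` to `1`.
  filter_upwards [(isOpen_lt continuous_const continuous_norm).mem_nhds (hrK x hx)] with y hy
  change ((1 - χ y) * (u : Net d) ε y + ∑ k ∈ Finset.range (L ε), ((2 : ℝ) ^ k) ^ (-α) •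
    (ψ ((2 : ℝ) ^ k • y) * (u : Net d) ε ((2 : ℝ) ^ k • y))) - (u : Net d) ε y = _
  rw [← Finset.sum_subset (Finset.range_mono hLn) (fun k _ hk => by
    rw [hψ2 _ (hbig k (by simpa using hk) y hy), zero_mul, smul_zero])]
  simp only [mul_sub, Finset.sum_sub_distrib, ← Finset.sum_mul]
  rw [hψs, hχ2 _ (hbig n le_rfl y hy)]
  simp only [mul_smul_comm]
  ring

end Colombeau

theorem mainTheorem5 (d : ℕ) (hd : 1 ≤ d) (α : ℝ) (u : Colombeau (Colombeau.punctured d))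
    (hu : u ≠ 0) (hα : Colombeau.IsHomogeneous (Colombeau.isConic_punctured d) α u) :
    Colombeau.IsExtendable u ∧
      (Colombeau.IsExtendableAsHomogeneous u → ∃ n : ℕ, α = n) :=
  ⟨hα.isExtendable, fun h => h.degree_eq_natCast hu hα⟩
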